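/- For integers $p\ge 3$ and $k\ge 0$, the lollipop $L(p,k)$ is the graph on $p+k$ vertices obtained from a cycle $C_p$ on $p$ vertices and a path $P_{k+1}$ on $k+1$ vertices by identifying one vertex of the cycle with an end vertex of the path (so $L(p,0)=C_p$). Two finite simple graphs are called cospectral if their adjacency matrices have the same eigenvalues with the same multiplicities. **Theorem.** Let $p\ge 3$ be odd and let $k\ge 0$. If $G$ is a finite simple graph that is cospectral with $L(p,k)$, then $G$ is isomorphic to $L(p,k)$. -/

import Mathlib

namespace SimpleGraph

universe u v

/-- The coalescence of `G` with distinguished vertex `a` and `H` with distinguished vertex `b`: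
the two vertices `a` and `b` are identified. The merged vertex is represented by `Sum.inl a`;
it has the neighbours of `a` in `G` and the neighbours of `b` in `H`. -/
def coalescence {V : Type u} {W : Type v} (G : SimpleGraph V) (a : V)
    (H : SimpleGraph W) (b : W) : SimpleGraph (V ⊕ {y : W // y ≠ b}) where
  Adj
    | Sum.inl x, Sum.inl x' => G.Adj x x'
    | Sum.inl x, Sum.inr y => x = a ∧ H.Adj b y.1
    | Sum.inr y, Sum.inl x => x = a ∧ H.Adj b y.1
    | Sum.inr y, Sum.inr y' => H.Adj y.1 y'.1
  symm := ⟨by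
    rintro (x | y) (x' | y') h
    · exact h.symm
    · exact h
    · exact h
    · exact h.symm⟩
  loopless := ⟨by
    rintro (x | y) h
    · exact G.loopless.irrefl x h
    · exact H.loopless.irrefl y.1 h⟩

/-- The lollipop `L(p,k)`: the coalescence of the cycle on `p ≥ 3` vertices and the path on `k + 1`
vertices, the distinguished vertex of the path being one of its ends. In particular `L(p,0)` is the
cycle itself. -/
def lollipop (p k : ℕ) (hp : 3 ≤ p) : SimpleGraph (Fin p ⊕ {y : Fin (k + 1) // y ≠ 0}) :=
  (cycleGraph p).coalescence ⟨0, by omega⟩ (pathGraph (k + 1)) 0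

open Classical in
/-- The spectrum of a finite graph: the multiset of the (real) eigenvalues of its adjacency matrix,
i.e. the roots of its characteristic polynomial, counted with multiplicity. -/
noncomputable def adjSpectrum {V : Type u} [Fintype V] (G : SimpleGraph V) : Multiset ℝ :=
  (G.adjMatrix ℝ).charpoly.roots

/-- Two finite graphs are cospectral if their adjacency matrices have the same eigenvalues, with the
same multiplicities. -/
def IsCospectral {V : Type u} {W : Type v} [Fintype V] [Fintype W]
    (G : SimpleGraph V) (H : SimpleGraph W) : Prop :=
  G.adjSpectrum = H.adjSpectrum

end SimpleGraph

/-!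
Let `G` be cospectral with `L(p,k)`, `p` odd. The graphs have the same number `n` of vertices and
the same number of closed walks of each length (`IsCospectral.exists_closed_walk` and the trace
lemmas before it). Closed walks of lengths two and four give `∑ deg = 2 n` for `G` and, as `L(p,k)`
has no four-cycle, an upper bound for `∑ deg ^ 2` (`IsCospectral.sum_degree_sq_le`). In terms of the
excess `deg - 2` this says that the sum is zero and that the sum of squares is at most `2`, or `0`
if `k = 0`. Hence `G` is `2`-regular, or it has one vertex of degree one, one of degree three, and
all others of degree two; the second case needs `k ≠ 0`. A maximal path, started at the vertex of
degree one if there is one, then exhibits a component of `G` as a lollipop or a cycle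
(`exists_tadpole_component`).

If `k ≠ 0`, then `2` is not an eigenvalue of `L(p,k)` (`tadpole_eigenvector_two_eq_zero`), whereas
the indicator function of a `2`-regular union of components is an eigenvector for it
(`exists_eigenvector_two`). So `G` has no such components and is itself a lollipop `L(p',k')`. The
odd girth, read off from the closed walks of odd length, gives `p' = p`
(`tadpole_cycle_length_eq`). If `k = 0`, the component of a vertex on a closed walk of odd length
`p = n` is an odd cycle of length at most `p`, and the odd girth forces it to be all of `G`.

The lollipop is handled in a model on `Fin (k + p)`, the `tadpole`. Reducing its numbering modulo
`p` maps it homomorphically to the cycle of length `p`, so that a closed walk of odd length `l`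
yields an odd multiple of `p` of absolute value at most `l` (`Walk.odd_and_le_length`).
-/

namespace SimpleGraph

universe u v

/-! ### Invariants of cospectral graphs -/

section Spectral

variable {V : Type u} {W : Type v} [Fintype V] [Fintype W]

theorem adjSpectrum_eq_roots [DecidableEq V] (G : SimpleGraph V) [DecidableRel G.Adj] :
    G.adjSpectrum = (G.adjMatrix ℝ).charpoly.roots := by
  unfold adjSpectrum
  congr!

theorem _root_.Matrix.IsHermitian.trace_pow_eq_sum_roots_charpoly [DecidableEq V]
    {A : Matrix V V ℝ} (hA : A.IsHermitian) (l : ℕ) :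
    (A ^ l).trace = (A.charpoly.roots.map (· ^ l)).sum := by
  have h : (A ^ l).trace = ∑ i, hA.eigenvalues i ^ l := by
    conv_lhs => rw [hA.spectral_theorem, ← map_pow, Unitary.conjStarAlgAut_apply,
      Matrix.trace_mul_cycle]
    simp [Matrix.diagonal_pow, Matrix.trace]
  rw [h, hA.roots_charpoly_eq_eigenvalues]
  simp

variable {G : SimpleGraph V} {H : SimpleGraph W}

theorem IsCospectral.symm (h : G.IsCospectral H) : H.IsCospectral G := Eq.symm h

theorem IsCospectral.trans {U : Type*} [Fintype U] {K : SimpleGraph U}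
    (h : G.IsCospectral H) (h' : H.IsCospectral K) : G.IsCospectral K := Eq.trans h h'

theorem Iso.isCospectral (e : G ≃g H) : G.IsCospectral H := by
  classical
  rw [IsCospectral, adjSpectrum_eq_roots, adjSpectrum_eq_roots, ← e.reindex_adjMatrix ℝ,
    Matrix.charpoly_reindex]

theorem IsCospectral.charpoly_eq [DecidableEq V] [DecidableEq W] [DecidableRel G.Adj]
    [DecidableRel H.Adj] (h : G.IsCospectral H) :
    (G.adjMatrix ℝ).charpoly = (H.adjMatrix ℝ).charpoly := by
  have hr := h
  rw [IsCospectral, adjSpectrum_eq_roots, adjSpectrum_eq_roots] at hr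
  rw [(G.isHermitian_adjMatrix ℝ).splits_charpoly.eq_prod_roots_of_monic
      (Matrix.charpoly_monic _), hr,
    ← (H.isHermitian_adjMatrix ℝ).splits_charpoly.eq_prod_roots_of_monic (Matrix.charpoly_monic _)]

theorem IsCospectral.card_eq (h : G.IsCospectral H) : Fintype.card V = Fintype.card W := by
  classical
  simpa [Matrix.charpoly_natDegree_eq_dim] using congrArg Polynomial.natDegree h.charpoly_eq

theorem IsCospectral.trace_pow_eq [DecidableEq V] [DecidableEq W] [DecidableRel G.Adj]
    [DecidableRel H.Adj] (h : G.IsCospectral H) (l : ℕ) :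
    ((G.adjMatrix ℝ) ^ l).trace = ((H.adjMatrix ℝ) ^ l).trace := by
  rw [(G.isHermitian_adjMatrix ℝ).trace_pow_eq_sum_roots_charpoly,
    (H.isHermitian_adjMatrix ℝ).trace_pow_eq_sum_roots_charpoly, h.charpoly_eq]

theorem trace_adjMatrix_pow_ne_zero_iff [DecidableEq V] [DecidableRel G.Adj] (l : ℕ) :
    ((G.adjMatrix ℝ) ^ l).trace ≠ 0 ↔ ∃ v, ∃ w : G.Walk v v, w.length = l := by
  rw [Matrix.trace, Ne, Finset.sum_eq_zero_iff_of_nonneg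
    (fun i _ => by simp [adjMatrix_pow_apply_eq_card_walk])]
  simp only [Finset.mem_univ, forall_const, Matrix.diag_apply, adjMatrix_pow_apply_eq_card_walk,
    Nat.cast_eq_zero, Fintype.card_eq_zero_iff, not_forall, not_isEmpty_iff]
  exact exists_congr fun v => ⟨fun ⟨w⟩ => ⟨w.1, w.2⟩, fun ⟨w, hw⟩ => ⟨⟨w, hw⟩⟩⟩

/-- Cospectral graphs have closed walks of the same lengths, because the `l`-th power sum of the
spectrum is the number of closed walks of length `l`. -/
theorem IsCospectral.exists_closed_walk (h : G.IsCospectral H) {l : ℕ}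
    (hw : ∃ v, ∃ w : G.Walk v v, w.length = l) : ∃ v, ∃ w : H.Walk v v, w.length = l := by
  classical
  rw [← trace_adjMatrix_pow_ne_zero_iff] at hw ⊢
  rwa [← h.trace_pow_eq]

theorem trace_adjMatrix_sq (G : SimpleGraph V) [DecidableEq V] [DecidableRel G.Adj] :
    ((G.adjMatrix ℝ) ^ 2).trace = ∑ v, (G.degree v : ℝ) := by
  rw [pow_two, Matrix.trace]
  exact Finset.sum_congr rfl fun v _ => G.adjMatrix_mul_self_apply_self v

theorem IsCospectral.sum_degree_eq [DecidableRel G.Adj] [DecidableRel H.Adj]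
    (h : G.IsCospectral H) : ∑ v, G.degree v = ∑ w, H.degree w := by
  classical
  have := h.trace_pow_eq 2
  rw [trace_adjMatrix_sq, trace_adjMatrix_sq] at this
  exact_mod_cast this

theorem adjMatrix_mul_self_apply [DecidableEq V] (G : SimpleGraph V) [DecidableRel G.Adj]
    (v w : V) : (G.adjMatrix ℝ * G.adjMatrix ℝ) v w =
      (Finset.card {u | G.Adj v u ∧ G.Adj u w} : ℝ) := by
  simp only [Matrix.mul_apply, adjMatrix_apply, mul_ite, mul_one, mul_zero, ← ite_and,
    Finset.sum_boole, and_comm]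

theorem sum_adjMatrix_mul_self [DecidableEq V] (G : SimpleGraph V) [DecidableRel G.Adj] :
    ∑ v, ∑ w, (G.adjMatrix ℝ * G.adjMatrix ℝ) v w = ∑ v, (G.degree v : ℝ) ^ 2 := by
  have hrow : ∀ v, ∑ w, G.adjMatrix ℝ v w = G.degree v := fun v => by
    simp [adjMatrix_apply, Finset.sum_boole, ← card_neighborFinset_eq_degree,
      neighborFinset_eq_filter]
  have hcol : ∀ v, ∑ w, G.adjMatrix ℝ w v = G.degree v := fun v => by
    rw [← hrow v]
    exact Finset.sum_congr rfl fun w _ => by simp [adjMatrix_apply, G.adj_comm]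
  calc ∑ v, ∑ w, (G.adjMatrix ℝ * G.adjMatrix ℝ) v w
      = ∑ u, (∑ v, G.adjMatrix ℝ v u) * ∑ w, G.adjMatrix ℝ u w := by
        simp only [Matrix.mul_apply, Finset.sum_mul_sum]
        rw [Finset.sum_comm' (t' := Finset.univ) (s' := fun _ => Finset.univ) (by simp)]
        conv_lhs => enter [2, v]; rw [Finset.sum_comm]
        rw [Finset.sum_comm]
        refine Finset.sum_congr rfl fun u _ => ?_
        rw [Finset.sum_comm]
    _ = _ := by simp only [hrow, hcol, pow_two]

/-- Separating the degenerate closed walks of length four, which backtrack, from the four-cycles: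
the latter are counted by the pairs of distinct vertices with several common neighbours. -/
theorem trace_adjMatrix_pow_four [DecidableEq V] (G : SimpleGraph V) [DecidableRel G.Adj] :
    ((G.adjMatrix ℝ) ^ 4).trace = 2 * ∑ v, (G.degree v : ℝ) ^ 2 - ∑ v, (G.degree v : ℝ) +
      ∑ v, ∑ w ∈ Finset.univ.erase v, ((G.adjMatrix ℝ * G.adjMatrix ℝ) v w ^ 2 -
        (G.adjMatrix ℝ * G.adjMatrix ℝ) v w) := by
  set A := G.adjMatrix ℝ with hA
  have hsymm : ∀ v w, (A * A) v w = (A * A) w v := fun v w => by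
    rw [← Matrix.transpose_apply (A * A), Matrix.transpose_mul, transpose_adjMatrix]
  have htr : (A ^ 4).trace = ∑ v, ∑ w, (A * A) v w ^ 2 := by
    rw [show A ^ 4 = (A * A) * (A * A) by noncomm_ring, Matrix.trace]
    refine Finset.sum_congr rfl fun v _ => ?_
    rw [Matrix.diag_apply, Matrix.mul_apply]
    exact Finset.sum_congr rfl fun w _ => by rw [hsymm w v, pow_two]
  have hdiag : ∀ v, ∑ w, ((A * A) v w ^ 2 - (A * A) v w) = ((G.degree v : ℝ) ^ 2 - G.degree v) +
      ∑ w ∈ Finset.univ.erase v, ((A * A) v w ^ 2 - (A * A) v w) := fun v => by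
    rw [← Finset.add_sum_erase _ _ (Finset.mem_univ v), hA, adjMatrix_mul_self_apply_self]
  have h := Finset.sum_congr (rfl : (Finset.univ : Finset V) = _) fun v _ => hdiag v
  simp only [Finset.sum_sub_distrib, Finset.sum_add_distrib] at h
  rw [sum_adjMatrix_mul_self, ← htr] at h
  simp only [Finset.sum_sub_distrib]
  linarith

/-- Among graphs cospectral with a graph without four-cycles, that graph has the largest sum of
squared degrees. -/
theorem IsCospectral.sum_degree_sq_le [DecidableRel G.Adj] [DecidableRel H.Adj]
    (h : G.IsCospectral H)
    (hH : ∀ v w x y, v ≠ w → H.Adj v x → H.Adj x w → H.Adj v y → H.Adj y w → x = y) :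
    ∑ v, (G.degree v : ℤ) ^ 2 ≤ ∑ w, (H.degree w : ℤ) ^ 2 := by
  classical
  have h4 := h.trace_pow_eq 4
  rw [trace_adjMatrix_pow_four, trace_adjMatrix_pow_four] at h4
  have hd : ∑ v, (G.degree v : ℝ) = ∑ w, (H.degree w : ℝ) := by exact_mod_cast h.sum_degree_eq
  have hG0 : 0 ≤ ∑ v, ∑ w ∈ Finset.univ.erase v, ((G.adjMatrix ℝ * G.adjMatrix ℝ) v w ^ 2 -
      (G.adjMatrix ℝ * G.adjMatrix ℝ) v w) := by
    refine Finset.sum_nonneg fun v _ => Finset.sum_nonneg fun w _ => ?_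
    rw [adjMatrix_mul_self_apply, sub_nonneg]
    exact_mod_cast Nat.le_self_pow two_ne_zero _
  have hH0 : ∑ v, ∑ w ∈ Finset.univ.erase v, ((H.adjMatrix ℝ * H.adjMatrix ℝ) v w ^ 2 -
      (H.adjMatrix ℝ * H.adjMatrix ℝ) v w) = 0 := by
    refine Finset.sum_eq_zero fun v _ => Finset.sum_eq_zero fun w hw => ?_
    have hc : Finset.card {u | H.Adj v u ∧ H.Adj u w} ≤ 1 := by
      refine Finset.card_le_one.2 fun x hx y hy => ?_
      rw [Finset.mem_filter] at hx hy
      exact hH v w x y (Finset.ne_of_mem_erase hw).symm hx.2.1 hx.2.2 hy.2.1 hy.2.2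
    rw [adjMatrix_mul_self_apply]
    interval_cases Finset.card {u | H.Adj v u ∧ H.Adj u w} <;> simp
  have : ∑ v, (G.degree v : ℝ) ^ 2 ≤ ∑ w, (H.degree w : ℝ) ^ 2 := by linarith
  exact_mod_cast this

theorem IsCospectral.exists_eigenvector [DecidableRel G.Adj] [DecidableRel H.Adj]
    (h : G.IsCospectral H) (c : ℝ)
    (hx : ∃ x : V → ℝ, x ≠ 0 ∧ ∀ v, ∑ u ∈ G.neighborFinset v, x u = c * x v) :
    ∃ x : W → ℝ, x ≠ 0 ∧ ∀ v, ∑ u ∈ H.neighborFinset v, x u = c * x v := by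
  classical
  obtain ⟨x, hx0, hx⟩ := hx
  have hdet : (Matrix.scalar V c - G.adjMatrix ℝ).det = 0 := by
    refine Matrix.exists_mulVec_eq_zero_iff.1 ⟨x, hx0, ?_⟩
    ext v
    simp [Matrix.sub_mulVec, adjMatrix_mulVec_apply, hx]
  rw [← Matrix.eval_charpoly, h.charpoly_eq, Matrix.eval_charpoly] at hdet
  obtain ⟨y, hy0, hy⟩ := Matrix.exists_mulVec_eq_zero_iff.2 hdet
  refine ⟨y, hy0, fun v => ?_⟩
  have := congrFun hy v
  simp only [Matrix.sub_mulVec, Pi.sub_apply, adjMatrix_mulVec_apply, Pi.zero_apply] at this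
  simp [Matrix.scalar_apply, Matrix.mulVec_diagonal] at this
  linarith

/-- If every vertex outside an adjacency-closed proper set has degree two, then two is an
eigenvalue: the indicator function of the complement is an eigenvector. -/
theorem exists_eigenvector_two [DecidableRel G.Adj] {S : Set V}
    (hS : ∀ x ∈ S, ∀ y, G.Adj x y → y ∈ S) (hne : ∃ x, x ∉ S) (hdeg : ∀ x ∉ S, G.degree x = 2) :
    ∃ x : V → ℝ, x ≠ 0 ∧ ∀ v, ∑ u ∈ G.neighborFinset v, x u = 2 * x v := by
  classical
  obtain ⟨a, ha⟩ := hne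
  refine ⟨fun v => if v ∈ S then 0 else 1, fun h0 => by simpa [ha] using congrFun h0 a,
    fun v => ?_⟩
  by_cases hv : v ∈ S
  · rw [Finset.sum_eq_zero]
    · simp [hv]
    · intro u hu
      rw [mem_neighborFinset] at hu
      simp [hS v hv u hu]
  · rw [Finset.sum_congr rfl (g := fun _ => (1 : ℝ))]
    · simp [hdeg v hv, hv]
    · intro u hu
      rw [mem_neighborFinset] at hu
      have : u ∉ S := fun hu' => hv (hS u hu' v hu.symm)
      simp [this]

end Spectral

/-! ### Tadpole graphs -/

section Tadpole

/-- The tadpole graph: the path `0, 1, …, k + p - 1` together with the edge joining `k` to the last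
vertex. It is the lollipop `L(p,k)` with its vertices numbered along the path from the pendant
end. -/
def tadpole (p k : ℕ) : SimpleGraph (Fin (k + p)) :=
  fromRel fun i j => (i : ℕ) + 1 = j ∨ ((i : ℕ) = k ∧ (j : ℕ) + 1 = k + p)

instance (p k : ℕ) : DecidableRel (tadpole p k).Adj := by
  unfold tadpole
  infer_instance

theorem tadpole_adj {p k : ℕ} (hp : 3 ≤ p) {i j : Fin (k + p)} :
    (tadpole p k).Adj i j ↔ (i : ℕ) + 1 = j ∨ (j : ℕ) + 1 = i ∨
      ((i : ℕ) = k ∧ (j : ℕ) + 1 = k + p) ∨ ((j : ℕ) = k ∧ (i : ℕ) + 1 = k + p) := by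
  rw [tadpole, fromRel_adj, Ne, Fin.ext_iff]
  omega

/-- The cycle is laid out on `k, …, k + p - 1` and the path of the lollipop runs backwards from
`k` to `0`. -/
theorem nonempty_lollipop_iso_tadpole (p k : ℕ) (hp : 3 ≤ p) :
    Nonempty (lollipop p k hp ≃g tadpole p k) := by
  let f : Fin p ⊕ {y : Fin (k + 1) // y ≠ 0} → Fin (k + p) :=
    Sum.elim (fun c => ⟨k + c, by omega⟩) (fun y => ⟨k - y.1, by omega⟩)
  have hval : ∀ y : {y : Fin (k + 1) // y ≠ 0}, (y.1 : ℕ) ≠ 0 := fun y h => y.2 (Fin.ext h)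
  have hinj : Function.Injective f := by
    rintro (c | y) (c' | y') h <;> simp only [f, Sum.elim_inl, Sum.elim_inr,
      Sum.inl.injEq, Sum.inr.injEq, Subtype.ext_iff, Fin.ext_iff, reduceCtorEq] at h ⊢
    · omega
    · have := hval y'
      omega
    · have := hval y
      omega
    · omega
  have hbij : Function.Bijective f :=
    (Fintype.bijective_iff_injective_and_card f).2 ⟨hinj, by
      simp [Fintype.card_subtype_compl]; omega⟩
  refine ⟨⟨Equiv.ofBijective f hbij, ?_⟩⟩
  have hcyc : ∀ c c' : Fin p, (cycleGraph p).Adj c c' ↔ (c : ℕ) + 1 = c' ∨ (c' : ℕ) + 1 = c ∨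
      ((c : ℕ) = 0 ∧ (c' : ℕ) + 1 = p) ∨ ((c' : ℕ) = 0 ∧ (c : ℕ) + 1 = p) := by
    intro c c'
    rw [cycleGraph_adj']
    rcases lt_trichotomy c c' with h | rfl | h
    · rw [Fin.sub_val_of_le h.le, Fin.coe_sub_iff_lt.2 h]
      rw [Fin.lt_def] at h
      omega
    · have : NeZero p := ⟨by omega⟩
      rw [sub_self, Fin.coe_ofNat_eq_mod, Nat.zero_mod]
      omega
    · rw [Fin.sub_val_of_le h.le, Fin.coe_sub_iff_lt.2 h]
      rw [Fin.lt_def] at h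
      omega
  rintro (c | y) (c' | y') <;>
    simp only [Equiv.ofBijective_apply, f, Sum.elim_inl, Sum.elim_inr, tadpole_adj hp, lollipop,
      coalescence, hcyc, pathGraph_adj, Fin.ext_iff, Fin.coe_ofNat_eq_mod, Nat.zero_mod]
  · omega
  · have := hval y'
    omega
  · have := hval y
    omega
  · have := hval y
    have := hval y'
    omega

variable {p k : ℕ}

theorem tadpole_no_four_cycle (hp : 3 ≤ p) (hp4 : p ≠ 4) (v w x y : Fin (k + p)) (hvw : v ≠ w)
    (h1 : (tadpole p k).Adj v x) (h2 : (tadpole p k).Adj x w) (h3 : (tadpole p k).Adj v y)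
    (h4 : (tadpole p k).Adj y w) : x = y := by
  rw [tadpole_adj hp] at h1 h2 h3 h4
  rw [Ne, Fin.ext_iff] at hvw
  rw [Fin.ext_iff]
  omega

/-- The neighbourhoods as sets of natural numbers, which avoids arithmetic in `Fin`. -/
theorem neighborFinset_tadpole_map (hp : 3 ≤ p) (i : Fin (k + p)) :
    ((tadpole p k).neighborFinset i).map Fin.valEmbedding =
      if (i : ℕ) = k then
        if k = 0 then {1, p - 1} else {k - 1, k + 1, k + p - 1}
      else if (i : ℕ) + 1 = k + p then {k + p - 2, k}
      else if (i : ℕ) = 0 then {1} else {(i : ℕ) - 1, (i : ℕ) + 1} := by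
  ext j
  simp only [Finset.mem_map, mem_neighborFinset, Fin.valEmbedding_apply, tadpole_adj hp]
  have : (∃ a : Fin (k + p), ((i : ℕ) + 1 = a ∨ (a : ℕ) + 1 = i ∨
      ((i : ℕ) = k ∧ (a : ℕ) + 1 = k + p) ∨ ((a : ℕ) = k ∧ (i : ℕ) + 1 = k + p)) ∧ (a : ℕ) = j) ↔
      j < k + p ∧ ((i : ℕ) + 1 = j ∨ j + 1 = i ∨
      ((i : ℕ) = k ∧ j + 1 = k + p) ∨ (j = k ∧ (i : ℕ) + 1 = k + p)) :=
    ⟨fun ⟨a, ha, hj⟩ => hj ▸ ⟨a.2, ha⟩, fun ⟨hj, h⟩ => ⟨⟨j, hj⟩, h, rfl⟩⟩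
  rw [this]
  have hi := i.2
  split_ifs <;> simp only [Finset.mem_insert, Finset.mem_singleton] <;> omega

theorem degree_tadpole (hp : 3 ≤ p) (i : Fin (k + p)) :
    (tadpole p k).degree i =
      if k = 0 then 2 else if (i : ℕ) = 0 then 1 else if (i : ℕ) = k then 3 else 2 := by
  rw [← card_neighborFinset_eq_degree, ← Finset.card_map Fin.valEmbedding,
    neighborFinset_tadpole_map hp]
  have hi := i.2
  split_ifs <;> first
    | omega
    | simp
    | rw [Finset.card_pair (by omega)]
    | (rw [Finset.card_insert_of_notMem, Finset.card_pair (by omega)]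
       simp only [Finset.mem_insert, Finset.mem_singleton]
       omega)

theorem sum_degree_tadpole (hp : 3 ≤ p) :
    ∑ i, ((tadpole p k).degree i : ℤ) = 2 * (k + p : ℕ) := by
  have h : ∀ i : Fin (k + p), ((tadpole p k).degree i : ℤ) = 2 +
      ((if i = ⟨k, by omega⟩ then 1 else 0) - (if i = ⟨0, by omega⟩ then 1 else 0)) := by
    intro i
    rw [degree_tadpole hp]
    simp only [Fin.ext_iff]
    split_ifs <;> simp <;> omega
  simp only [h, Finset.sum_add_distrib, Finset.sum_sub_distrib]
  simp [mul_comm]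

theorem sum_degree_sq_tadpole (hp : 3 ≤ p) :
    ∑ i, ((tadpole p k).degree i : ℤ) ^ 2 = 4 * (k + p : ℕ) + if k = 0 then 0 else 2 := by
  have h : ∀ i : Fin (k + p), ((tadpole p k).degree i : ℤ) ^ 2 = 4 + (if k = 0 then 0 else
      ((if i = ⟨k, by omega⟩ then 5 else 0) - (if i = ⟨0, by omega⟩ then 3 else 0))) := by
    intro i
    rw [degree_tadpole hp]
    simp only [Fin.ext_iff]
    split_ifs <;> simp
    omega
  simp only [h, Finset.sum_add_distrib]
  split_ifs
  · simp; ring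
  · simp [Finset.sum_sub_distrib]; ring

/-- Along a walk that stays in an adjacency-closed set on which `f` changes by `±1` across each
edge, `f` changes by a sum of `length` signs. -/
theorem Walk.exists_int_sub {V : Type u} {G : SimpleGraph V} {R : Type*} [Ring R] {S : Set V}
    (hS : ∀ x ∈ S, ∀ y, G.Adj x y → y ∈ S) {f : V → R}
    (hf : ∀ x ∈ S, ∀ y, G.Adj x y → f y = f x + 1 ∨ f y = f x - 1) {a b : V} (w : G.Walk a b)
    (ha : a ∈ S) : ∃ s : ℤ, |s| ≤ w.length ∧ (2 : ℤ) ∣ w.length - s ∧ f b = f a + s := by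
  induction w with
  | nil => exact ⟨0, by simp⟩
  | @cons x y z h w ih =>
    obtain ⟨s, hs, h2, hfs⟩ := ih (hS _ ha _ h)
    rw [abs_le] at hs
    rw [length_cons]
    rcases hf _ ha _ h with h' | h'
    · refine ⟨s + 1, abs_le.2 (by omega), by omega, ?_⟩
      rw [hfs, h']
      push_cast
      abel
    · refine ⟨s - 1, abs_le.2 (by omega), by omega, ?_⟩
      rw [hfs, h']
      push_cast
      abel

/-- If an adjacency-closed set admits a labelling in `ZMod q` that changes by `±1` across each
edge, then a closed walk of odd length in it forces `q` to be odd and at most that length. -/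
theorem Walk.odd_and_le_length {V : Type u} {G : SimpleGraph V} {q : ℕ} {S : Set V}
    (hS : ∀ x ∈ S, ∀ y, G.Adj x y → y ∈ S) {f : V → ZMod q}
    (hf : ∀ x ∈ S, ∀ y, G.Adj x y → f y = f x + 1 ∨ f y = f x - 1) {a : V} (w : G.Walk a a)
    (ha : a ∈ S) (hodd : Odd w.length) : Odd q ∧ q ≤ w.length := by
  obtain ⟨s, hs, h2, hfs⟩ := w.exists_int_sub hS hf ha
  have hq : (q : ℤ) ∣ s := by
    rw [← ZMod.intCast_zmod_eq_zero_iff_dvd]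
    simpa using hfs.symm
  have hso : Odd s := by
    obtain ⟨r, hr⟩ := hodd
    rw [hr] at h2
    rw [Int.odd_iff]
    omega
  refine ⟨?_, ?_⟩
  · obtain ⟨r, hr⟩ := hq
    rw [hr] at hso
    exact_mod_cast (Int.odd_mul.1 hso).1
  · have := Int.le_of_dvd (abs_pos.2 (by rintro rfl; simp at hso)) ((dvd_abs _ _).2 hq)
    omega

/-- Reducing the numbering modulo `p` is a homomorphism to the cycle: the closing edge joins `k` to
`k + p - 1 ≡ k - 1`. -/
theorem tadpole_adj_zmod (hp : 3 ≤ p) {i j : Fin (k + p)} (h : (tadpole p k).Adj i j) :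
    ((j : ℕ) : ZMod p) = (i : ℕ) + 1 ∨ ((j : ℕ) : ZMod p) = (i : ℕ) - 1 := by
  rw [tadpole_adj hp] at h
  rcases h with h | h | ⟨h, h'⟩ | ⟨h, h'⟩
  · exact .inl (by rw [← h]; push_cast; rfl)
  · exact .inr (by rw [← h]; push_cast; ring)
  · have := congrArg (Nat.cast : ℕ → ZMod p) h'
    push_cast [ZMod.natCast_self] at this
    exact .inr (by rw [h, ← add_zero (k : ZMod p), ← this]; ring)
  · have := congrArg (Nat.cast : ℕ → ZMod p) h'
    push_cast [ZMod.natCast_self] at this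
    exact .inl (by rw [h, ← add_zero (k : ZMod p), ← this])

theorem tadpole_odd_and_le_of_closed_walk (hp : 3 ≤ p) {l : ℕ} (hl : Odd l)
    (hw : ∃ v, ∃ w : (tadpole p k).Walk v v, w.length = l) : Odd p ∧ p ≤ l := by
  obtain ⟨v, w, rfl⟩ := hw
  exact w.odd_and_le_length (S := Set.univ) (f := fun i : Fin (k + p) => ((i : ℕ) : ZMod p))
    (by simp)
    (fun x _ y h => tadpole_adj_zmod hp h) (Set.mem_univ _) hl

theorem tadpole_exists_closed_walk (hp : 3 ≤ p) :
    ∃ v, ∃ w : (tadpole p k).Walk v v, w.length = p := by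
  have h : ∀ i (hi : i < p), ∃ w : (tadpole p k).Walk ⟨k, by omega⟩ ⟨k + i, by omega⟩,
      w.length = i := by
    intro i
    induction i with
    | zero => exact fun _ => ⟨.nil, rfl⟩
    | succ i ih =>
      intro hi
      obtain ⟨w, hw⟩ := ih (by omega)
      exact ⟨w.concat ((tadpole_adj hp).2 (.inl rfl)), by simp [hw]⟩
  obtain ⟨w, hw⟩ := h (p - 1) (by omega)
  refine ⟨_, w.concat ((tadpole_adj hp).2 (.inr (.inr (.inr ⟨rfl, ?_⟩)))), ?_⟩
  · simp only; omega
  · rw [Walk.length_concat, hw]; omega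

/-- Odd girth distinguishes cospectral tadpoles one of whose cycles is odd. -/
theorem tadpole_cycle_length_eq {p' k' : ℕ} (hp : 3 ≤ p) (hp' : 3 ≤ p') (hodd : Odd p)
    (h : (tadpole p' k').IsCospectral (tadpole p k)) : p' = p := by
  obtain ⟨hodd', hle⟩ := tadpole_odd_and_le_of_closed_walk hp' hodd
    (h.symm.exists_closed_walk (tadpole_exists_closed_walk hp))
  exact hle.antisymm (tadpole_odd_and_le_of_closed_walk hp hodd'
    (h.exists_closed_walk (tadpole_exists_closed_walk hp'))).2

/-- A tadpole with a tail does not have the eigenvalue two. An eigenvector is linear along the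
tail, and its restriction to the cycle is linear with equal end values, hence constant; the
equation at the branch vertex then makes it vanish. -/
theorem tadpole_eigenvector_two_eq_zero (hp : 3 ≤ p) (hk : k ≠ 0) {x : Fin (k + p) → ℝ}
    (hx : ∀ v, ∑ u ∈ (tadpole p k).neighborFinset v, x u = 2 * x v) : x = 0 := by
  -- Extended by zero to all of `ℕ`, so that indices need no bounds.
  obtain ⟨y, rfl⟩ : ∃ y : ℕ → ℝ, x = fun i : Fin (k + p) => y i :=
    ⟨fun n => if h : n < k + p then x ⟨n, h⟩ else 0, by ext i; simp⟩
  have hy : ∀ i (hi : i < k + p), ∑ u ∈ ((tadpole p k).neighborFinset ⟨i, hi⟩).map Fin.valEmbedding,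
      y u = 2 * y i := by
    intro i hi
    rw [Finset.sum_map]
    exact hx ⟨i, hi⟩
  simp only [neighborFinset_tadpole_map hp] at hy
  have h0 : y 1 = 2 * y 0 := by
    have := hy 0 (by omega)
    rwa [if_neg (by omega), if_neg (by omega), if_pos rfl, Finset.sum_singleton] at this
  have hmid : ∀ i, i + 2 < k + p → i + 1 ≠ k → y (i + 2) = 2 * y (i + 1) - y i := by
    intro i hi hik
    have := hy (i + 1) (by omega)
    rw [if_neg hik, if_neg (by omega), if_neg (by omega), Finset.sum_pair (by omega)] at this
    simp only [Nat.add_sub_cancel] at this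
    linarith
  have hbranch : y (k - 1) + (y (k + 1) + y (k + p - 1)) = 2 * y k := by
    have := hy k (by omega)
    rwa [if_pos rfl, if_neg hk, Finset.sum_insert (by
      simp only [Finset.mem_insert, Finset.mem_singleton]; omega),
      Finset.sum_pair (by omega)] at this
  have hlast : y (k + p - 2) + y k = 2 * y (k + p - 1) := by
    have := hy (k + p - 1) (by omega)
    rwa [if_neg (by omega), if_pos (by omega), Finset.sum_pair (by omega)] at this
  have htail : ∀ i, i < k → y i = (i + 1) * y 0 ∧ y (i + 1) = (i + 2) * y 0 := by
    intro i
    induction i with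
    | zero => intro _; constructor <;> simp [h0]
    | succ i ih =>
      intro hi
      obtain ⟨h1, h2⟩ := ih (by omega)
      refine ⟨by rw [h2]; push_cast; ring, ?_⟩
      rw [hmid i (by omega) (by omega), h1, h2]
      push_cast
      ring
  have hcyc : ∀ i, i + 1 < p → y (k + i) = y k + i * (y (k + 1) - y k) ∧
      y (k + (i + 1)) = y k + (i + 1) * (y (k + 1) - y k) := by
    intro i
    induction i with
    | zero => intro _; constructor <;> simp
    | succ i ih =>
      intro hi
      obtain ⟨h1, h2⟩ := ih (by omega)
      refine ⟨by rw [h2]; push_cast; ring, ?_⟩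
      have := hmid (k + i) (by omega) (by omega)
      rw [add_assoc k i 1, add_assoc k i 2] at this
      rw [this, h1, h2]
      push_cast
      ring
  obtain ⟨m, rfl⟩ : ∃ m, k = m + 1 := ⟨k - 1, by omega⟩
  obtain ⟨q, rfl⟩ : ∃ q, p = q + 2 := ⟨p - 2, by omega⟩
  have e1 := hcyc q (by omega)
  rw [show m + 1 + (q + 2) - 2 = m + 1 + q by omega,
    show m + 1 + (q + 2) - 1 = m + 1 + (q + 1) by omega, e1.1, e1.2] at hlast
  rw [show m + 1 + (q + 2) - 1 = m + 1 + (q + 1) by omega, e1.2] at hbranch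
  have hd : y (m + 1 + 1) - y (m + 1) = 0 := by
    have : (q + 2 : ℝ) * (y (m + 1 + 1) - y (m + 1)) = 0 := by linarith
    exact (mul_eq_zero.1 this).resolve_left (by positivity)
  have ht := htail m (by omega)
  rw [hd, Nat.add_sub_cancel, ht.1] at hbranch
  have hy0 : y 0 = 0 := by
    have : (m + 1 : ℝ) * y 0 = 0 := by linarith
    exact (mul_eq_zero.1 this).resolve_left (by positivity)
  ext i
  simp only [Pi.zero_apply]
  by_cases hi : (i : ℕ) < m + 1
  · rw [(htail i hi).1, hy0, mul_zero]
  · obtain ⟨j, hj⟩ : ∃ j, (i : ℕ) = m + 1 + j := ⟨i - (m + 1), by omega⟩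
    have hyk : y (m + 1) = 0 := by rw [ht.2, hy0, mul_zero]
    rcases j with _ | j
    · rw [hj, Nat.add_zero, hyk]
    · rw [hj, (hcyc j (by omega)).2, hd, hyk]
      simp

end Tadpole

/-! ### Graphs with the degree sequence of a lollipop -/

section Structure

variable {V : Type u} [Fintype V] {G : SimpleGraph V}

/-- A path from `a` whose last vertex `v m` has all its neighbours on the path; the values of `v`
beyond `m` are irrelevant. -/
theorem exists_maximal_path (G : SimpleGraph V) (a : V) :
    ∃ m, ∃ v : ℕ → V, v 0 = a ∧ Set.InjOn v (Set.Iic m) ∧ (∀ i < m, G.Adj (v i) (v (i + 1))) ∧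
      ∀ y, G.Adj (v m) y → ∃ j ≤ m, y = v j := by
  classical
  let P : ℕ → Prop := fun m => ∃ v : ℕ → V, v 0 = a ∧ Set.InjOn v (Set.Iic m) ∧
    ∀ i < m, G.Adj (v i) (v (i + 1))
  have hbound : ∀ m, P m → m ≤ Fintype.card V := by
    rintro m ⟨v, -, hinj, -⟩
    have := Finset.card_le_univ ((Finset.Iic m).image v)
    rw [Finset.card_image_of_injOn (by simpa using hinj), Nat.card_Iic] at this
    omega
  have h0 : P 0 := ⟨fun _ => a, rfl, by
    intro i hi j hj _
    simp only [Set.mem_Iic] at hi hj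
    omega, by simp⟩
  set m := Nat.findGreatest P (Fintype.card V) with hm
  obtain ⟨v, hv0, hinj, hadj⟩ : P m := Nat.findGreatest_spec (Nat.zero_le _) h0
  refine ⟨m, v, hv0, hinj, hadj, fun y hy => ?_⟩
  by_contra! hne
  have hsucc : P (m + 1) := by
    have hlt : ∀ i, i ≤ m → Function.update v (m + 1) y i = v i := fun i hi =>
      Function.update_of_ne (by omega) _ _
    refine ⟨Function.update v (m + 1) y, by rw [hlt 0 (Nat.zero_le _), hv0], ?_, ?_⟩
    · intro i hi j hj hij
      rw [Set.mem_Iic] at hi hj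
      rcases Nat.lt_or_eq_of_le hi with hi | rfl <;> rcases Nat.lt_or_eq_of_le hj with hj | rfl
      · rw [hlt i (by omega), hlt j (by omega)] at hij
        exact hinj (Nat.lt_succ_iff.1 hi) (Nat.lt_succ_iff.1 hj) hij
      · rw [hlt i (by omega), Function.update_self] at hij
        exact absurd hij.symm (hne i (by omega))
      · rw [hlt j (by omega), Function.update_self] at hij
        exact absurd hij (hne j (by omega))
      · rfl
    · intro i hi
      rcases Nat.lt_or_eq_of_le (Nat.lt_succ_iff.1 hi) with hi | rfl
      · rw [hlt i (by omega), hlt (i + 1) (by omega)]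
        exact hadj i hi
      · rw [hlt m le_rfl, Function.update_self]
        exact hy
  have := Nat.le_findGreatest (hbound _ hsucc) hsucc
  omega

section Copy

variable {W : Type v} [Fintype W] {H : SimpleGraph W} [DecidableRel G.Adj] [DecidableRel H.Adj]
  {f : W → V}

theorem degree_le_of_injective_hom (hinj : Function.Injective f)
    (hf : ∀ x y, H.Adj x y → G.Adj (f x) (f y)) (w : W) : H.degree w ≤ G.degree (f w) := by
  classical
  rw [← card_neighborFinset_eq_degree, ← card_neighborFinset_eq_degree,
    ← Finset.card_image_of_injective _ hinj]
  refine Finset.card_le_card fun y hy => ?_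
  obtain ⟨x, hx, rfl⟩ := Finset.mem_image.1 hy
  rw [mem_neighborFinset] at hx ⊢
  exact hf _ _ hx

/-- An injective homomorphism that does not increase degrees is onto on neighbourhoods. -/
theorem exists_adj_of_degree_le (hinj : Function.Injective f)
    (hf : ∀ x y, H.Adj x y → G.Adj (f x) (f y)) (hdeg : ∀ w, G.degree (f w) ≤ H.degree w)
    (w : W) (y : V) (hy : G.Adj (f w) y) : ∃ w', H.Adj w w' ∧ f w' = y := by
  classical
  have heq : (H.neighborFinset w).image f = G.neighborFinset (f w) := by
    refine Finset.eq_of_subset_of_card_le (fun y hy => ?_) ?_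
    · obtain ⟨x, hx, rfl⟩ := Finset.mem_image.1 hy
      rw [mem_neighborFinset] at hx ⊢
      exact hf _ _ hx
    · rw [Finset.card_image_of_injective _ hinj]
      exact hdeg w
  rw [← mem_neighborFinset, ← heq, Finset.mem_image] at hy
  obtain ⟨w', hw', rfl⟩ := hy
  exact ⟨w', (mem_neighborFinset _ _ _).1 hw', rfl⟩

end Copy

/-- A maximal path from `a` is closed up by a second neighbour of its last vertex; the degrees
leave no room for further edges, so that this tadpole is a whole component. -/
theorem exists_tadpole_component [DecidableRel G.Adj] (a : V)
    (h : (G.degree a = 1 ∧ ∃ b, G.degree b = 3 ∧ ∀ x, x ≠ a → x ≠ b → G.degree x = 2) ∨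
      ∀ x, G.degree x = 2) :
    ∃ p k, 3 ≤ p ∧ ((∀ x, G.degree x = 2) → k = 0) ∧ ∃ f : Fin (k + p) → V,
      Function.Injective f ∧ (∀ i j, (tadpole p k).Adj i j → G.Adj (f i) (f j)) ∧
      (∀ i y, G.Adj (f i) y → ∃ j, (tadpole p k).Adj i j ∧ f j = y) ∧ a ∈ Set.range f ∧
      ∀ x ∉ Set.range f, G.degree x = 2 := by
  classical
  obtain ⟨m, v, hv0, hinj, hadj, hmax⟩ := exists_maximal_path G a
  have ha1 : 1 ≤ G.degree a := by
    rcases h with h | h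
    · exact h.1.ge
    · rw [h a]; omega
  have h2 : ∀ x, x ≠ a → 2 ≤ G.degree x := by
    intro x hx
    rcases h with ⟨-, b, hb, h⟩ | h
    · by_cases hxb : x = b
      · rw [hxb, hb]; omega
      · rw [h x hx hxb]
    · rw [h x]
  have hm : m ≠ 0 := by
    rintro rfl
    obtain ⟨y, hy⟩ := (G.degree_pos_iff_exists_adj a).1 ha1
    obtain ⟨j, hj, rfl⟩ := hmax y (hv0 ▸ hy)
    rw [Nat.le_zero.1 hj, hv0] at hy
    exact G.irrefl hy
  have hvm : v m ≠ a := fun hvm => hm (hinj (Set.mem_Iic.2 le_rfl) (Set.mem_Iic.2 (Nat.zero_le _))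
    (hvm.trans hv0.symm))
  obtain ⟨y, hy, hy'⟩ := Finset.exists_mem_ne (s := G.neighborFinset (v m))
    (by rw [card_neighborFinset_eq_degree]; exact h2 _ hvm) (v (m - 1))
  rw [mem_neighborFinset] at hy
  obtain ⟨k, hk, rfl⟩ := hmax y hy
  have hkm : k ≠ m := by rintro rfl; exact G.irrefl hy
  have hkm' : k ≠ m - 1 := by rintro rfl; exact hy' rfl
  have hp : 3 ≤ m + 1 - k := by omega
  have hkp : k + (m + 1 - k) = m + 1 := by omega
  set p := m + 1 - k with hpdef
  have hle : ∀ i : Fin (k + p), (i : ℕ) ≤ m := fun i => by have := i.2; omega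
  let f : Fin (k + p) → V := fun i => v i
  have hfinj : Function.Injective f := fun i j hij => Fin.ext (hinj (hle i) (hle j) hij)
  have hf : ∀ i j, (tadpole p k).Adj i j → G.Adj (f i) (f j) := by
    intro i j hij
    have hi := hle i
    have hj := hle j
    rw [tadpole_adj hp] at hij
    rcases hij with hij | hij | ⟨hi', hj'⟩ | ⟨hj', hi'⟩
    · simpa only [f, hij] using hadj i (by omega)
    · simpa only [f, hij] using (hadj j (by omega)).symm
    · have hjm : (j : ℕ) = m := by omega
      simpa only [f, hi', hjm] using hy.symm
    · have him : (i : ℕ) = m := by omega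
      simpa only [f, hj', him] using hy
  -- Degrees in `G` are at least those of the tadpole; this decides which vertex has degree three.
  have hdeg := degree_le_of_injective_hom hfinj hf
  simp only [degree_tadpole hp] at hdeg
  let z : Fin (k + p) := ⟨0, by omega⟩
  let c : Fin (k + p) := ⟨k, by omega⟩
  have hfz : f z = a := hv0
  have hdz := hdeg z
  have hdc := hdeg c
  rcases h with ⟨ha, b, hb, h⟩ | h
  · have hk0 : k ≠ 0 := by
      intro hk0
      rw [if_pos hk0, hfz] at hdz
      omega
    have hca : f c ≠ a := fun hca => hk0 (congrArg Fin.val (hfinj (hca.trans hfz.symm)))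
    have hcb : f c = b := by
      by_contra hcb
      rw [if_neg hk0, if_neg hk0, if_pos rfl, h _ hca hcb] at hdc
      omega
    refine ⟨p, k, hp, fun h2 => absurd (h2 a) (by omega), f, hfinj, hf,
      exists_adj_of_degree_le hfinj hf fun i => ?_, ⟨z, hfz⟩, fun x hx => h x ?_ ?_⟩
    · rw [degree_tadpole hp, if_neg hk0]
      split_ifs with hi0 hik
      · rw [show i = z from Fin.ext hi0, hfz, ha]
      · rw [show i = c from Fin.ext hik, hcb, hb]
      · refine (h _ (fun hia => hi0 ?_) fun hib => hik ?_).le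
        · exact congrArg Fin.val (hfinj (hia.trans hfz.symm))
        · exact congrArg Fin.val (hfinj (hib.trans hcb.symm))
    · rintro rfl
      exact hx ⟨z, hfz⟩
    · rintro rfl
      exact hx ⟨c, hcb⟩
  · have hk0 : k = 0 := by
      by_contra hk0
      rw [if_neg hk0, if_neg hk0, if_pos rfl, h] at hdc
      omega
    refine ⟨p, k, hp, fun _ => hk0, f, hfinj, hf,
      exists_adj_of_degree_le hfinj hf fun i => ?_, ⟨z, hfz⟩, fun x _ => h x⟩
    rw [degree_tadpole hp, if_pos hk0, h]

end Structure

/-- Applied to the excess degrees `e x = deg x - 2`, this determines the degree sequence. -/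
theorem eq_zero_or_eq_single_sub_single {ι : Type*} [Fintype ι] {e : ι → ℤ} (h0 : ∑ x, e x = 0)
    (h2 : ∑ x, e x ^ 2 ≤ 2) :
    (∀ x, e x = 0) ∨ ∃ a b, e a = -1 ∧ e b = 1 ∧ ∀ x, x ≠ a → x ≠ b → e x = 0 := by
  classical
  by_cases hz : ∀ x, e x = 0
  · exact .inl hz
  push Not at hz
  obtain ⟨x₀, hx₀⟩ := hz
  obtain ⟨b, -, hb⟩ := Finset.exists_pos_of_sum_zero_of_exists_nonzero e h0
    ⟨x₀, Finset.mem_univ _, hx₀⟩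
  obtain ⟨a, -, ha⟩ := Finset.exists_pos_of_sum_zero_of_exists_nonzero (fun x => -e x)
    (by rw [Finset.sum_neg_distrib, h0, neg_zero]) ⟨x₀, Finset.mem_univ _, neg_ne_zero.2 hx₀⟩
  have hab : a ≠ b := by rintro rfl; omega
  have hle : ∀ s : Finset ι, ∑ x ∈ s, e x ^ 2 ≤ 2 := fun s =>
    (Finset.sum_le_sum_of_subset_of_nonneg (Finset.subset_univ s)
      fun x _ _ => sq_nonneg (e x)).trans h2
  have hs := hle {a, b}
  rw [Finset.sum_pair hab] at hs
  refine .inr ⟨a, b, by nlinarith, by nlinarith, fun x hxa hxb => ?_⟩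
  have hx := hle {x, a, b}
  rw [Finset.sum_insert (by simp [hxa, hxb]), Finset.sum_pair hab] at hx
  have : e x ^ 2 ≤ 0 := by nlinarith
  exact pow_eq_zero_iff two_ne_zero |>.1 (le_antisymm this (sq_nonneg _))

/-! ### Lollipops with an odd cycle -/

theorem nonempty_iso_tadpole_of_isCospectral {V : Type u} [Fintype V] {G : SimpleGraph V} {p k : ℕ}
    (hp : 3 ≤ p) (hodd : Odd p) (h : G.IsCospectral (tadpole p k)) :
    Nonempty (G ≃g tadpole p k) := by
  classical
  have hcard : Fintype.card V = k + p := by simpa using h.card_eq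
  have : Nonempty V := Fintype.card_pos_iff.1 (by omega)
  have hsum : ∑ x, ((G.degree x : ℤ) - 2) = 0 := by
    have h1 : ∑ x, (G.degree x : ℤ) = 2 * (k + p : ℕ) := by
      rw [← sum_degree_tadpole hp]
      exact_mod_cast h.sum_degree_eq
    rw [Finset.sum_sub_distrib, h1]
    simp [hcard]
    ring
  have hsq : ∑ x, ((G.degree x : ℤ) - 2) ^ 2 ≤ if k = 0 then 0 else 2 := by
    have h2 := h.sum_degree_sq_le
      (tadpole_no_four_cycle hp (by rintro rfl; exact absurd hodd (by decide)))
    rw [sum_degree_sq_tadpole hp] at h2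
    have h3 : ∑ x, ((G.degree x : ℤ) - 2) ^ 2 =
        ∑ x, (G.degree x : ℤ) ^ 2 - 4 * ∑ x, ((G.degree x : ℤ) - 2) - 4 * (k + p : ℕ) := by
      rw [← hcard, Finset.mul_sum, ← Finset.sum_sub_distrib, mul_comm (4 : ℤ),
        ← nsmul_eq_mul, ← Finset.card_univ, ← Finset.sum_const, ← Finset.sum_sub_distrib]
      exact Finset.sum_congr rfl fun x _ => by ring
    rw [h3, hsum]
    linarith
  -- An adjacency-closed copy of a tadpole that fills `V` is all of `G`.
  have hiso : ∀ {p' k' : ℕ} {f : Fin (k' + p') → V}, Function.Bijective f →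
      (∀ i j, (tadpole p' k').Adj i j → G.Adj (f i) (f j)) →
      (∀ i y, G.Adj (f i) y → ∃ j, (tadpole p' k').Adj i j ∧ f j = y) →
      Nonempty (tadpole p' k' ≃g G) := fun {p' k' f} hbij hf hf' =>
    ⟨⟨Equiv.ofBijective f hbij, fun {i j} => ⟨fun hij => by
      obtain ⟨j', hj', he⟩ := hf' i _ hij
      rwa [← hbij.1 he], hf i j⟩⟩⟩
  by_cases hk : k = 0
  · subst hk
    have hdeg : ∀ x, G.degree x = 2 := by
      intro x
      rw [if_pos rfl] at hsq
      have := (Finset.sum_eq_zero_iff_of_nonneg fun x _ => sq_nonneg ((G.degree x : ℤ) - 2)).1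
        (le_antisymm hsq (Finset.sum_nonneg fun x _ => sq_nonneg _)) x (Finset.mem_univ x)
      have := pow_eq_zero_iff two_ne_zero |>.1 this
      omega
    -- The component of a vertex on a closed walk of length `p` is a cycle whose length `p'` is odd
    -- and at most `p`; since `p` is the odd girth of the right-hand side, it is equal to `p`.
    obtain ⟨a, w, hw⟩ := h.symm.exists_closed_walk (tadpole_exists_closed_walk hp)
    obtain ⟨p', k', hp', hk', f, hinj, hf, hf', ha, -⟩ := exists_tadpole_component a (.inr hdeg)
    obtain rfl := hk' hdeg
    obtain ⟨hodd', hle⟩ := w.odd_and_le_length (q := p') (S := Set.range f)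
      (f := Function.extend f (fun i => ((i : ℕ) : ZMod p')) 0)
      (by
        rintro _ ⟨i, rfl⟩ y hy
        obtain ⟨j, -, rfl⟩ := hf' i y hy
        exact ⟨j, rfl⟩)
      (by
        rintro _ ⟨i, rfl⟩ y hy
        obtain ⟨j, hij, rfl⟩ := hf' i y hy
        rw [hinj.extend_apply, hinj.extend_apply]
        exact tadpole_adj_zmod hp' hij) ha (hw ▸ hodd)
    have hge : p ≤ p' := by
      obtain ⟨u, w', hw'⟩ := tadpole_exists_closed_walk (k := 0) hp'
      let φ : tadpole p' 0 →g G := ⟨f, fun {i j} => hf i j⟩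
      exact (tadpole_odd_and_le_of_closed_walk hp hodd'
        (h.exists_closed_walk ⟨φ u, w'.map φ, by rw [Walk.length_map, hw']⟩)).2
    obtain rfl : p' = p := le_antisymm (hw ▸ hle) hge
    obtain ⟨e⟩ := hiso
      ((Fintype.bijective_iff_injective_and_card f).2 ⟨hinj, by simp [hcard]⟩) hf hf'
    exact ⟨e.symm⟩
  · -- The eigenvalue two is excluded, so neither `G` nor a part of it can be `2`-regular.
    have hclosed : ∀ S : Set V, (∀ x ∈ S, ∀ y, G.Adj x y → y ∈ S) →
        (∀ x ∉ S, G.degree x = 2) → ∀ x, x ∈ S := by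
      intro S hS hdeg
      by_contra! hne
      obtain ⟨x, hx0, hx⟩ := h.exists_eigenvector 2 (exists_eigenvector_two hS hne hdeg)
      exact hx0 (tadpole_eigenvector_two_eq_zero hp hk hx)
    rw [if_neg hk] at hsq
    rcases eq_zero_or_eq_single_sub_single hsum hsq with h2 | ⟨a, b, ha, hb, h2⟩
    · obtain ⟨x⟩ := this
      exact absurd (hclosed ∅ (by simp) (fun x _ => by have := h2 x; omega) x)
        (Set.notMem_empty x)
    · obtain ⟨p', k', hp', -, f, hinj, hf, hf', -, hout⟩ :=
        exists_tadpole_component (G := G) a (.inl ⟨by omega, b, by omega,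
          fun x hxa hxb => by have := h2 x hxa hxb; omega⟩)
      have hsurj : Function.Surjective f := hclosed (Set.range f) (by
        rintro _ ⟨i, rfl⟩ y hy
        obtain ⟨j, -, rfl⟩ := hf' i y hy
        exact ⟨j, rfl⟩) hout
      obtain ⟨e⟩ := hiso ⟨hinj, hsurj⟩ hf hf'
      obtain rfl := tadpole_cycle_length_eq hp hp' hodd (e.isCospectral.trans h)
      have hkk : k' + p' = k + p' := by simpa [hcard] using Fintype.card_congr e.toEquiv
      obtain rfl : k' = k := by omega
      exact ⟨e.symm⟩

end SimpleGraph

theorem mainTheorem3 {V : Type*} [Fintype V] (G : SimpleGraph V) (p k : ℕ) (hp : 3 ≤ p)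
    (hodd : Odd p) (hG : G.IsCospectral (SimpleGraph.lollipop p k hp)) :
    Nonempty (G ≃g SimpleGraph.lollipop p k hp) := by
  obtain ⟨e⟩ := SimpleGraph.nonempty_lollipop_iso_tadpole p k hp
  obtain ⟨e'⟩ := SimpleGraph.nonempty_iso_tadpole_of_isCospectral hp hodd
    (hG.trans e.isCospectral)
  exact ⟨e'.trans e.symm⟩
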